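/- Let $n\ge 1$, $[6n]=\{1,\dots,6n\}$, and let $\sigma,\tau\in S_{6n}$ be permutations without fixed points, $\sigma$ of order $2$ and $\tau$ of order $3$. Let $b=\begin{pmatrix}0&1\\-1&0\end{pmatrix}$ and $c=\begin{pmatrix}0&1\\-1&1\end{pmatrix}$ in $\mathrm{PSL}(2,\mathbb Z)$. There is a unique group homomorphism $\Phi=\Phi(\sigma,\tau):\mathrm{PSL}(2,\mathbb Z)\to S_{6n}$ with $\Phi(b)=\sigma$ and $\Phi(c)=\tau$. Let $\mathrm{PSL}(2,\mathbb Z)$ act on $\mathbb H\times[6n]$, a disjoint union of $6n$ hyperbolic planes (distinct copies at distance $\infty$), by $\gamma(x,i)=(\gamma x,\Phi(\gamma)(i))$, and let $S=\mathrm{PSL}(2,\mathbb Z)\backslash_{\Phi}(\mathbb H\times[6n])$, with the quotient metric. Let $T\subset\mathbb H$ be the ideal triangle with vertices $0,1,\infty$; its sides have the mid-points $\mathbf i,\ 1+\mathbf i,\ \frac{1+\mathbf i}2$, and this clockwise order orients $T$ and directs its sides ($0\to\infty$, $\infty\to1$, $1\to0$). Write $\tau=(i_1^1i_1^2i_1^3)\cdots(i_{2n}^1i_{2n}^2i_{2n}^3)$.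 Take $2n$ copies $T_1,\dots,T_{2n}$ of $T$ and label the sides of $T_k$ by $i_k^1,i_k^2,i_k^3$ so that the cyclic order $(i_k^1i_k^2i_k^3)$ is that of the mid-points above. For each $2$-cycle $(j\ j')$ of $\sigma$ glue the sides labelled $j$ and $j'$ isometrically, with mid-points identified and via reverse directions. The resulting space, with the quotient (gluing) metric, is $S^O(\sigma,\tau)$. Here the quotient metric is the infimum of the lengths of finite chains; points in different components are at distance $\infty$. Then: 1. The quotient metric on $S$ induces the quotient topology, and the map $p:S\to\mathbb H/\mathrm{PSL}(2,\mathbb Z)$, $[(x,i)]\mapsto[x]$, makes $S$ a hyperbolic covering surface of degree $6n$ of the modular surface in the sense of orbifolds. That is, every $x\in\mathbb H$, with (finite) stabilizer $G_x$, has a ball $U$ around it such that $\gamma U\cap U=\emptyset$ for $\gamma\notin G_x$, and the preimage under $p$ of the image of $U$ in $\mathbb H/\mathrm{PSL}(2,\mathbb Z)$ is a disjoint union of $6n/|G_x|$ open sets, each isometric to $U$ by an isometry under which $p$ becomes the projection $U\to U/G_x$. In particular $p$ is a $6n$-sheeted covering away from the two cone points of the modular surface. 2. Labellings as in the construction of $S^O(\sigma,\tau)$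 exist, and for each of them $S$ is isometric to $S^O(\sigma,\tau)$. -/

import Mathlib

open scoped ENNReal UpperHalfPlane

namespace BrooksMakover

/-! ### Disjoint unions of copies and quotient metrics -/

/-- The disjoint union of copies of `X` indexed by `ι`. -/
@[ext]
structure Copies (ι X : Type*) where
  /-- the index of the copy -/
  idx : ι
  /-- the point of `X` -/
  pt : X

open Classical in
/-- Distinct copies are at distance `∞`; each copy carries the distance of `X`. -/
noncomputable instance Copies.instPseudoEMetricSpace {ι X : Type*} [PseudoEMetricSpace X] :
    PseudoEMetricSpace (Copies ι X) where
  edist p q := if p.idx = q.idx then edist p.pt q.pt else ⊤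
  edist_self p := by simp
  edist_comm p q := by simp only [edist_comm p.pt q.pt, eq_comm]
  edist_triangle p q r := by
    by_cases h1 : p.idx = q.idx
    · by_cases h2 : q.idx = r.idx
      · simpa [h1, h2] using edist_triangle p.pt q.pt r.pt
      · simp [h2]
    · simp [h1]

/-- `QuotientChain s x y ℓ`: there are points `a₁, b₁, …, a_m, b_m` (`m ≥ 0`) of `X` such that
`x = [a₁]`, `[b_i] = [a_{i+1}]`, `[b_m] = y` in the quotient of `X` by `s`
(and `x = y` if `m = 0`), and `ℓ = d(a₁, b₁) + ⋯ + d(a_m, b_m)`. -/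
inductive QuotientChain {X : Type*} [PseudoEMetricSpace X] (s : Setoid X) :
    Quotient s → Quotient s → ℝ≥0∞ → Prop
  | refl (x : Quotient s) : QuotientChain s x x 0
  | step (a b : X) (y : Quotient s) (l : ℝ≥0∞) :
      QuotientChain s (Quotient.mk s b) y l →
        QuotientChain s (Quotient.mk s a) y (edist a b + l)

theorem QuotientChain.append {X : Type*} [PseudoEMetricSpace X] {s : Setoid X}
    {x y z : Quotient s} {l m : ℝ≥0∞} (h : QuotientChain s x y l) (h' : QuotientChain s y z m) :
    QuotientChain s x z (l + m) := by
  induction h with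
  | refl x => simpa using h'
  | step a b y l _ ih =>
    rw [add_assoc]
    exact QuotientChain.step a b z _ (ih h')

theorem QuotientChain.reverse {X : Type*} [PseudoEMetricSpace X] {s : Setoid X}
    {x y : Quotient s} {l : ℝ≥0∞} (h : QuotientChain s x y l) : QuotientChain s y x l := by
  induction h with
  | refl x => exact QuotientChain.refl x
  | step a b y l _ ih =>
    have := ih.append (QuotientChain.step b a _ 0 (QuotientChain.refl _))
    rwa [add_zero, edist_comm, add_comm] at this

/-- The quotient of `X` by an equivalence relation, as a space with the quotient metric:
the distance of two points is the infimum of the lengths of the chains joining them. -/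
def MetricQuotient {X : Type*} [PseudoEMetricSpace X] (s : Setoid X) : Type _ := Quotient s

/-- The canonical projection onto the quotient. -/
def MetricQuotient.mk {X : Type*} [PseudoEMetricSpace X] (s : Setoid X) (a : X) :
    MetricQuotient s := Quotient.mk s a

noncomputable instance MetricQuotient.instPseudoEMetricSpace {X : Type*} [PseudoEMetricSpace X]
    (s : Setoid X) : PseudoEMetricSpace (MetricQuotient s) where
  edist x y := ⨅ (l : ℝ≥0∞) (_ : QuotientChain s x y l), l
  edist_self x := le_antisymm (iInf₂_le 0 (QuotientChain.refl x)) zero_le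
  edist_comm x y := le_antisymm
    (le_iInf₂ fun l hl => iInf₂_le l hl.reverse) (le_iInf₂ fun l hl => iInf₂_le l hl.reverse)
  edist_triangle x y z := by
    simp only [ENNReal.iInf_add, ENNReal.add_iInf]
    exact le_iInf₂ fun l hl => le_iInf₂ fun m hm => iInf₂_le _ (by
      first | exact hl.append hm | exact hm.append hl)

/-! ### The modular group and the modular surface -/

/-- The group `PSL(2, ℤ)`. -/
abbrev PSL2Z : Type := Matrix.ProjectiveSpecialLinearGroup (Fin 2) ℤ

/-- The Möbius action of `SL(2, ℤ)` on the upper half-plane descends to `PSL(2, ℤ)`. -/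
noncomputable def moebiusHom : PSL2Z →* Equiv.Perm ℍ :=
  QuotientGroup.lift (Subgroup.center (Matrix.SpecialLinearGroup (Fin 2) ℤ))
    (MulAction.toPermHom (Matrix.SpecialLinearGroup (Fin 2) ℤ) ℍ) (by
      intro g hg
      obtain ⟨r, hr, hg'⟩ := Matrix.SpecialLinearGroup.mem_center_iff.mp hg
      have h2 : r = 1 ∨ r = -1 := by simpa using hr
      refine Equiv.ext fun z => ?_
      rcases h2 with rfl | rfl
      · have : g = 1 := by
          ext i j; rw [← hg']; simp
        subst this; simp
      · have : g = -1 := by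
          ext i j; rw [← hg']; fin_cases i <;> fin_cases j <;> simp
        subst this
        change (-1 : Matrix.SpecialLinearGroup (Fin 2) ℤ) • z = z
        exact (ModularGroup.SL_neg_smul 1 z).trans (one_smul _ z))

/-- `PSL(2, ℤ)` acts on the upper half-plane by Möbius transformations. -/
noncomputable instance instMulActionPSL2Z : MulAction PSL2Z ℍ where
  smul γ z := moebiusHom γ z
  one_smul z := by
    change moebiusHom 1 z = z
    simp
  mul_smul γ δ z := by
    change moebiusHom (γ * δ) z = moebiusHom γ (moebiusHom δ z)
    simp

/-- The class of the matrix `(0 1; -1 0)`. -/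
def genB : PSL2Z :=
  QuotientGroup.mk (⟨!![0, 1; -1, 0], by simp⟩ : Matrix.SpecialLinearGroup (Fin 2) ℤ)

/-- The class of the matrix `(0 1; -1 1)`. -/
def genC : PSL2Z :=
  QuotientGroup.mk (⟨!![0, 1; -1, 1], by simp⟩ : Matrix.SpecialLinearGroup (Fin 2) ℤ)

/-- The modular surface `ℍ / PSL(2, ℤ)`. -/
abbrev ModularSurface : Type := MulAction.orbitRel.Quotient PSL2Z ℍ

/-! ### Coverings of a quotient orbifold -/

/-- A map `p` from a metric space `X` to the quotient orbifold `M / G` is a *covering surface of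
degree `d`* if it is an orbifold covering of degree `d` that is a local isometry in orbifold
charts, with trivial local groups on `X`.

Every `x : M` has a ball `U` whose translates by elements outside the stabilizer `G_x` are disjoint
from it, so that `U / G_x` is a chart of the orbifold `M / G`, and this chart is covered as follows:
its preimage under `p` is the disjoint union of `m` open sets, each of them the image of an
isometric copy `φ j` of `U` on which `p` is the projection `U → U / G_x`.
The degree is `m * |G_x|`: each of the `m` sheets `U → U / G_x` has degree `|G_x|`. -/
def IsOrbifoldCoveringSurface {G M X : Type*} [Group G] [PseudoMetricSpace M] [MulAction G M]
    [PseudoEMetricSpace X] (p : X → MulAction.orbitRel.Quotient G M) (d : ℕ) : Prop :=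
  ∀ x : M, ∃ r : ℝ, 0 < r ∧
    (∀ γ : G, (∃ a ∈ Metric.ball x r, γ • a ∈ Metric.ball x r) → γ ∈ MulAction.stabilizer G x) ∧
    ∃ (m : ℕ) (φ : Fin m → M → X),
      Finite (MulAction.stabilizer G x) ∧
      m * Nat.card (MulAction.stabilizer G x) = d ∧
      (∀ j, ∀ a ∈ Metric.ball x r, ∀ b ∈ Metric.ball x r,
        edist (φ j a) (φ j b) = edist a b) ∧
      (∀ j, IsOpen (φ j '' Metric.ball x r)) ∧
      (∀ j, ∀ a ∈ Metric.ball x r, p (φ j a) = Quotient.mk (MulAction.orbitRel G M) a) ∧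
      (∀ j k, j ≠ k → Disjoint (φ j '' Metric.ball x r) (φ k '' Metric.ball x r)) ∧
      p ⁻¹' (Quotient.mk (MulAction.orbitRel G M) '' Metric.ball x r) =
        ⋃ j, φ j '' Metric.ball x r

/-! ### Pairs of permutations and the associated quotient of `ℍ × [6n]` -/

/-- The set of pairs `(σ, τ)` of fixed-point-free permutations of `6n` elements, `σ` of order `2`
and `τ` of order `3`. -/
def permPairs (n : ℕ) : Set (Equiv.Perm (Fin (6 * n)) × Equiv.Perm (Fin (6 * n))) :=
  {q | orderOf q.1 = 2 ∧ (∀ i, q.1 i ≠ i) ∧ orderOf q.2 = 3 ∧ (∀ i, q.2 i ≠ i)}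

/-- The action `γ (x, i) = (γ x, Φ(γ) i)` of `PSL(2, ℤ)` on `ℍ × [N]`, the disjoint union of
`N` copies of the hyperbolic plane. -/
@[reducible]
noncomputable def twistedAction {N : ℕ} (Φ : PSL2Z →* Equiv.Perm (Fin N)) :
    MulAction PSL2Z (Copies (Fin N) ℍ) where
  smul γ p := ⟨Φ γ p.idx, γ • p.pt⟩
  one_smul p := by
    change (⟨Φ 1 p.idx, (1 : PSL2Z) • p.pt⟩ : Copies (Fin N) ℍ) = p
    simp
  mul_smul γ δ p := by
    change (⟨Φ (γ * δ) p.idx, (γ * δ) • p.pt⟩ : Copies (Fin N) ℍ) =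
      ⟨Φ γ (Φ δ p.idx), γ • δ • p.pt⟩
    simp [mul_smul]

/-- The orbit relation of `PSL(2, ℤ)` on `ℍ × [N]`. -/
noncomputable def twistedOrbitRel {N : ℕ} (Φ : PSL2Z →* Equiv.Perm (Fin N)) :
    Setoid (Copies (Fin N) ℍ) :=
  @MulAction.orbitRel PSL2Z (Copies (Fin N) ℍ) _ (twistedAction Φ)

/-- The quotient space `PSL(2, ℤ) \_Φ ℍ × [N]`, with the quotient metric. -/
abbrev TwistedQuotient {N : ℕ} (Φ : PSL2Z →* Equiv.Perm (Fin N)) : Type :=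
  MetricQuotient (twistedOrbitRel Φ)

/-- The projection `[(x, i)] ↦ [x]` to the modular surface. -/
noncomputable def twistedProj {N : ℕ} (Φ : PSL2Z →* Equiv.Perm (Fin N)) :
    TwistedQuotient Φ → ModularSurface :=
  Quotient.lift (fun p : Copies (Fin N) ℍ => Quotient.mk (MulAction.orbitRel PSL2Z ℍ) p.pt) (by
    rintro p q ⟨γ, hγ⟩
    exact Quotient.sound ⟨γ, congrArg Copies.pt hγ⟩)

/-! ### The gluing of ideal triangles -/

/-- The hyperbolic ideal triangle with vertices `0, 1, ∞` (it is geodesically convex, so the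
distance of `ℍ` restricts to its intrinsic distance). -/
def idealTriangle : Set ℍ :=
  {z | 0 ≤ z.re ∧ z.re ≤ 1 ∧ (1 / 2) ^ 2 ≤ (z.re - 1 / 2) ^ 2 + z.im ^ 2}

/-- The three sides of the ideal triangle, parametrized by signed arc length from the mid-points
`i`, `1 + i`, `(1 + i) / 2` (sides `0`, `1`, `2`, respectively), in the directions induced by the
clockwise orientation: `0 → ∞`, `∞ → 1` and `1 → 0`. -/
noncomputable def sidePoint : Fin 3 → ℝ → ℍ
  | 0, t => ⟨⟨0, Real.exp t⟩, Real.exp_pos t⟩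
  | 1, t => ⟨⟨1, Real.exp (-t)⟩, Real.exp_pos (-t)⟩
  | 2, t => ⟨⟨1 / (1 + Real.exp t ^ 2), Real.exp t / (1 + Real.exp t ^ 2)⟩, by
      change 0 < Real.exp t / (1 + Real.exp t ^ 2)
      positivity⟩

theorem sidePoint_mem (s : Fin 3) (t : ℝ) : sidePoint s t ∈ idealTriangle := by
  have h := Real.exp_pos t
  fin_cases s
  · change (0 : ℝ) ≤ 0 ∧ (0 : ℝ) ≤ 1 ∧ (1 / 2 : ℝ) ^ 2 ≤ (0 - 1 / 2) ^ 2 + Real.exp t ^ 2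
    refine ⟨le_rfl, zero_le_one, ?_⟩
    nlinarith [sq_nonneg (Real.exp t)]
  · change (0 : ℝ) ≤ 1 ∧ (1 : ℝ) ≤ 1 ∧ (1 / 2 : ℝ) ^ 2 ≤ (1 - 1 / 2) ^ 2 + Real.exp (-t) ^ 2
    refine ⟨zero_le_one, le_rfl, ?_⟩
    nlinarith [sq_nonneg (Real.exp (-t))]
  · change (0 : ℝ) ≤ 1 / (1 + Real.exp t ^ 2) ∧ 1 / (1 + Real.exp t ^ 2) ≤ (1 : ℝ) ∧
      (1 / 2 : ℝ) ^ 2 ≤ (1 / (1 + Real.exp t ^ 2) - 1 / 2) ^ 2 +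
        (Real.exp t / (1 + Real.exp t ^ 2)) ^ 2
    have h1 : 0 < 1 + Real.exp t ^ 2 := by positivity
    refine ⟨by positivity, ?_, le_of_eq ?_⟩
    · rw [div_le_one h1]; nlinarith [sq_nonneg (Real.exp t)]
    · field_simp; ring

/-- A labelling of the sides of `2n` ideal triangles by `1, …, 6n` along the cycles of `τ`:
the labels of the sides of the `k`-th triangle, in the cyclic order of their mid-points
`i`, `1 + i`, `(1 + i) / 2`, form a cycle of `τ`. -/
structure TriangleLabelling (n : ℕ) (τ : Equiv.Perm (Fin (6 * n))) where
  /-- the label of side `s` of triangle `k` -/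
  label : Fin (2 * n) × Fin 3 ≃ Fin (6 * n)
  label_succ : ∀ (k : Fin (2 * n)) (s : Fin 3), label (k, s + 1) = τ (label (k, s))

/-- The sides with labels `j` and `σ j` are glued with their mid-points identified and via reverse
directions: the point with parameter `t` on the one is identified with the point with parameter
`-t` on the other. -/
inductive SideGluing {n : ℕ} {τ : Equiv.Perm (Fin (6 * n))} (σ : Equiv.Perm (Fin (6 * n)))
    (L : TriangleLabelling n τ) :
    Copies (Fin (2 * n)) idealTriangle → Copies (Fin (2 * n)) idealTriangle → Prop
  | glue (k k' : Fin (2 * n)) (s s' : Fin 3) (t : ℝ) (h : L.label (k', s') = σ (L.label (k, s))) :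
      SideGluing σ L ⟨k, ⟨sidePoint s t, sidePoint_mem s t⟩⟩
        ⟨k', ⟨sidePoint s' (-t), sidePoint_mem s' (-t)⟩⟩

/-- The surface `S^O(σ, τ)` obtained by gluing `2n` copies of the ideal triangle along their sides,
with the quotient metric. -/
abbrev GluedSurface {n : ℕ} {τ : Equiv.Perm (Fin (6 * n))} (σ : Equiv.Perm (Fin (6 * n)))
    (L : TriangleLabelling n τ) : Type :=
  MetricQuotient (Relation.EqvGen.setoid (SideGluing σ L))

end BrooksMakover

/-!
Everything rests on the Farey tessellation of `ℍ` by the images of the ideal triangle `T` with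
vertices `0, 1, ∞`. The generator `genC` turns `T`, and `genB` exchanges the two sides of the
imaginary axis, which contains a side of `T`. Since `T` is the intersection of the half-plane
`0 ≤ re z` with its images under the rotation, a reduced word in the generators pushes `T` off itself
by a ping-pong argument, unless it is a rotation or the passage to a neighbouring tile
(`eq_of_mem_of_smul_mem`). This one fact gives

* the free product structure of `PSL(2, ℤ)`, hence the homomorphism `Φ` (`existsUnique_hom`): it is
  the homomorphism whose graph is generated by `(genB, σ)` and `(genC, τ)`;
* local finiteness of the tessellation (`exists_finite_eventually_mem_idealTriangle`) and proper
  discontinuity (`exists_le_dist_smul`);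
* the elliptic elements: each one is conjugate to `genB` or to a power of `genC`, so `Φ` maps it to a
  permutation without fixed points (`eq_one_of_smul_eq_of_apply_eq`).

The group acts on `ℍ × [6n]` by isometries, so chains in the quotient lift
(`MetricQuotient.exists_edist_le_of_chain`). Therefore the projection is open, and the quotient metric
has the quotient topology. A local group `G_x` permutes the sheets freely, so a small ball around
`(x, i)` embeds isometrically, and one ball for each orbit of sheets fills the preimage of the chart
`U / G_x`.

For the isometry, put triangle `k` into the sheet that carries the label of its side `0`. This respects
the gluing and does not increase lengths of chains; it is injective because tiles meet only along
sides, and surjective because the tiles cover `ℍ`. The inverse, composed with the projection of a sheet,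
does not increase the distance of `z` to nearby points, since these share a tile with `z`. Along a
geodesic such pointwise estimates add up
(`edist_le_of_eventually_edist_le_upperHalfPlane`), so the inverse is `1`-Lipschitz as well.
-/

namespace BrooksMakover

open scoped Topology

/-! ### The generators of the modular group acting on the upper half-plane -/

theorem mk_smul (g : Matrix.SpecialLinearGroup (Fin 2) ℤ) (z : ℍ) :
    (QuotientGroup.mk g : PSL2Z) • z = g • z := rfl

theorem mk_eq_mk_of_eq_neg {g h : Matrix.SpecialLinearGroup (Fin 2) ℤ} (e : g = -h) :
    (QuotientGroup.mk g : PSL2Z) = QuotientGroup.mk h := by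
  rw [QuotientGroup.eq, Matrix.SpecialLinearGroup.mem_center_iff]
  refine ⟨-1, by simp, ?_⟩
  have : g⁻¹ * h = -1 := by
    rw [inv_mul_eq_iff_eq_mul, e]
    simp
  rw [this]
  ext i j
  fin_cases i <;> fin_cases j <;> simp

open ModularGroup in
theorem genB_eq : genB = QuotientGroup.mk S :=
  mk_eq_mk_of_eq_neg (Subtype.ext (by
    rw [Matrix.SpecialLinearGroup.coe_neg, coe_S]
    simp))

open ModularGroup in
theorem genC_eq : genC = QuotientGroup.mk (S * T⁻¹) :=
  mk_eq_mk_of_eq_neg (Subtype.ext (by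
    rw [Matrix.SpecialLinearGroup.coe_neg, Matrix.SpecialLinearGroup.coe_mul, coe_T_inv, coe_S]
    simp))

/-- `genB` acts by `z ↦ -1 / z`. -/
theorem coe_genB_smul (z : ℍ) : ((genB • z : ℍ) : ℂ) = -(z : ℂ)⁻¹ := by
  rw [genB_eq, mk_smul, UpperHalfPlane.coe_specialLinearGroup_apply]
  simp [ModularGroup.S, neg_div]

/-- `genC` acts by `z ↦ 1 / (1 - z)`, the rotation of the ideal triangle with `0 ↦ 1 ↦ ∞ ↦ 0`. -/
theorem coe_genC_smul (z : ℍ) : ((genC • z : ℍ) : ℂ) = (1 - (z : ℂ))⁻¹ := by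
  rw [genC_eq, mk_smul, UpperHalfPlane.coe_specialLinearGroup_apply]
  rw [← neg_sub (z : ℂ) 1, inv_neg]
  simp [ModularGroup.coe_S, neg_div, ← sub_eq_add_neg]

theorem one_sub_coe_ne_zero (z : ℍ) : (1 : ℂ) - z ≠ 0 := by
  intro h
  have := congrArg Complex.im h
  simp at this
  exact z.im_pos.ne' this

theorem coe_genC_sq_smul (z : ℍ) : ((genC ^ 2 • z : ℍ) : ℂ) = 1 - (z : ℂ)⁻¹ := by
  have h := one_sub_coe_ne_zero z
  have h0 : (z : ℂ) ≠ 0 := z.ne_zero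
  rw [pow_two, mul_smul, coe_genC_smul, coe_genC_smul]
  have : (1 : ℂ) - (1 - (z : ℂ))⁻¹ = -z / (1 - z) := by field_simp; ring
  rw [this, inv_div]
  field_simp
  ring

theorem genB_sq : genB ^ 2 = 1 := by
  rw [genB_eq, ← QuotientGroup.mk_pow, ← QuotientGroup.mk_one]
  refine mk_eq_mk_of_eq_neg (Subtype.ext ?_)
  rw [Matrix.SpecialLinearGroup.coe_pow, Matrix.SpecialLinearGroup.coe_neg, ModularGroup.coe_S]
  simp [pow_two, Matrix.one_fin_two]

theorem genC_pow_three : genC ^ 3 = 1 := by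
  rw [genC_eq, ← QuotientGroup.mk_pow, ← QuotientGroup.mk_one]
  refine congrArg _ (Subtype.ext ?_)
  rw [Matrix.SpecialLinearGroup.coe_pow, Matrix.SpecialLinearGroup.coe_mul,
    ModularGroup.coe_T_inv, ModularGroup.coe_S]
  simp [pow_succ, ← Matrix.one_fin_two]

theorem closure_genB_genC : Subgroup.closure {genB, genC} = (⊤ : Subgroup PSL2Z) := by
  have hT : (QuotientGroup.mk ModularGroup.T : PSL2Z) = genC⁻¹ * genB := by
    rw [genB_eq, genC_eq, ← QuotientGroup.mk_inv, ← QuotientGroup.mk_mul]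
    congr 1
    group
  have hB : genB ∈ Subgroup.closure {genB, genC} := Subgroup.subset_closure (by simp)
  have hC : genC ∈ Subgroup.closure {genB, genC} := Subgroup.subset_closure (by simp)
  rw [eq_top_iff, ← MonoidHom.range_eq_top.mpr (QuotientGroup.mk'_surjective
    (Subgroup.center (Matrix.SpecialLinearGroup (Fin 2) ℤ))), MonoidHom.range_eq_map,
    ← SpecialLinearGroup.SL2Z_generators, MonoidHom.map_closure, Subgroup.closure_le]
  rintro _ ⟨g, rfl | rfl, rfl⟩
  · change (QuotientGroup.mk ModularGroup.S : PSL2Z) ∈ _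
    rw [← genB_eq]; exact hB
  · change (QuotientGroup.mk ModularGroup.T : PSL2Z) ∈ _
    rw [hT]; exact mul_mem (inv_mem hC) hB

instance : IsIsometricSMul PSL2Z ℍ := by
  refine ⟨fun γ => ?_⟩
  induction γ using QuotientGroup.induction_on with
  | H g =>
    intro z w
    exact isometry_smul ℍ (Matrix.SpecialLinearGroup.map (Int.castRingHom ℝ) g) z w

/-! ### Signs of real parts -/

theorem re_inv_nonneg_iff (z : ℂ) : 0 ≤ z⁻¹.re ↔ 0 ≤ z.re := by
  by_cases h : z = 0
  · simp [h]
  · rw [Complex.inv_re, le_div_iff₀ (Complex.normSq_pos.mpr h), zero_mul]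

theorem re_inv_pos_iff (z : ℂ) : 0 < z⁻¹.re ↔ 0 < z.re := by
  by_cases h : z = 0
  · simp [h]
  · rw [Complex.inv_re, lt_div_iff₀ (Complex.normSq_pos.mpr h), zero_mul]

theorem re_genB_smul_neg {z : ℍ} (h : 0 < z.re) : (genB • z).re < 0 := by
  rw [← UpperHalfPlane.coe_re, coe_genB_smul, Complex.neg_re, neg_lt_zero, re_inv_pos_iff]
  exact h

theorem re_genB_smul_nonneg_iff {z : ℍ} : 0 ≤ (genB • z).re ↔ z.re ≤ 0 := by
  rw [← UpperHalfPlane.coe_re, coe_genB_smul, Complex.neg_re, neg_nonneg, ← not_lt,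
    re_inv_pos_iff, not_lt, UpperHalfPlane.coe_re]

theorem re_genB_smul_nonpos {z : ℍ} (h : 0 ≤ z.re) : (genB • z).re ≤ 0 := by
  rw [← UpperHalfPlane.coe_re, coe_genB_smul, Complex.neg_re, neg_nonpos, re_inv_nonneg_iff]
  exact h

theorem re_genC_smul_pos {z : ℍ} (h : z.re ≤ 0) : 0 < (genC • z).re := by
  rw [← UpperHalfPlane.coe_re, coe_genC_smul, re_inv_pos_iff, Complex.sub_re, Complex.one_re,
    UpperHalfPlane.coe_re]
  linarith

theorem re_genC_sq_smul_pos {z : ℍ} (h : z.re ≤ 0) : 0 < (genC ^ 2 • z).re := by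
  have := re_inv_pos_iff z
  rw [← UpperHalfPlane.coe_re, coe_genC_sq_smul, Complex.sub_re, Complex.one_re]
  rw [UpperHalfPlane.coe_re] at this
  have := (not_congr this).mpr h.not_gt
  linarith

theorem re_genC_pow_smul_pos {z : ℍ} (h : z.re ≤ 0) {s : Fin 3} (hs : s ≠ 0) :
    0 < (genC ^ (s : ℕ) • z).re := by
  fin_cases s
  · exact absurd rfl hs
  · simpa using re_genC_smul_pos h
  · exact re_genC_sq_smul_pos h

/-- The ideal triangle is the intersection of the half-plane `0 ≤ re z` with its images under the
rotation of order three. -/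
theorem mem_idealTriangle_iff {z : ℍ} :
    z ∈ idealTriangle ↔ 0 ≤ z.re ∧ 0 ≤ (genC • z).re ∧ 0 ≤ (genC ^ 2 • z).re := by
  have h1 : 0 ≤ (genC • z).re ↔ z.re ≤ 1 := by
    rw [← UpperHalfPlane.coe_re, coe_genC_smul, re_inv_nonneg_iff, Complex.sub_re, Complex.one_re,
      UpperHalfPlane.coe_re, sub_nonneg]
  have h2 : 0 ≤ (genC ^ 2 • z).re ↔ (1 / 2) ^ 2 ≤ (z.re - 1 / 2) ^ 2 + z.im ^ 2 := by
    have h0 : 0 < Complex.normSq (z : ℂ) := Complex.normSq_pos.mpr z.ne_zero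
    rw [← UpperHalfPlane.coe_re, coe_genC_sq_smul, Complex.sub_re, Complex.one_re, Complex.inv_re,
      sub_nonneg, div_le_one h0, Complex.normSq_apply, UpperHalfPlane.coe_re,
      UpperHalfPlane.coe_im]
    constructor <;> intro h <;> nlinarith
  rw [h1, h2, idealTriangle, Set.mem_ofPred_eq]

theorem genC_pow_smul_mem {z : ℍ} (h : z ∈ idealTriangle) (s : ℕ) :
    genC ^ s • z ∈ idealTriangle := by
  induction s with
  | zero => simpa
  | succ s ih =>
    rw [pow_succ', mul_smul]
    rw [mem_idealTriangle_iff] at ih ⊢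
    obtain ⟨h0, h1, h2⟩ := ih
    refine ⟨h1, by rwa [← mul_smul, ← pow_two], ?_⟩
    rwa [← mul_smul, ← pow_succ, genC_pow_three, one_smul]

theorem re_genC_pow_smul_nonneg {z : ℍ} (h : z ∈ idealTriangle) (s : ℕ) :
    0 ≤ (genC ^ s • z).re := (genC_pow_smul_mem h s).1

/-! ### Sides -/

/-- The rotation `genC` preserves the parametrizations of the sides and permutes them backwards. -/
theorem genC_smul_sidePoint (s : Fin 3) (t : ℝ) :
    genC • sidePoint (s + 1) t = sidePoint s t := by
  have h := Real.exp_pos t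
  have hq : (1 + Real.exp t ^ 2) ≠ 0 := by positivity
  apply UpperHalfPlane.ext
  rw [coe_genC_smul]
  apply inv_eq_of_mul_eq_one_left
  fin_cases s
  · apply Complex.ext <;> simp [sidePoint, ← Real.exp_add]
  · apply Complex.ext <;> simp [sidePoint, Real.exp_neg] <;> field_simp <;> ring
  · apply Complex.ext <;> simp [sidePoint] <;> field_simp <;> ring

theorem genC_pow_smul_sidePoint (s : Fin 3) (t : ℝ) :
    genC ^ (s : ℕ) • sidePoint s t = sidePoint 0 t := by
  have h0 := genC_smul_sidePoint 0 t
  have h1 := genC_smul_sidePoint 1 t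
  fin_cases s
  · simp
  · simpa using h0
  · change genC ^ 2 • sidePoint 2 t = _
    rw [pow_two, mul_smul]
    erw [h1]
    exact h0

theorem genB_smul_sidePoint (t : ℝ) : genB • sidePoint 0 t = sidePoint 0 (-t) := by
  apply UpperHalfPlane.ext
  rw [coe_genB_smul]
  apply Complex.ext <;> simp [sidePoint, Real.exp_neg, Complex.normSq_apply, neg_div]

theorem exists_sidePoint_eq {z : ℍ} (h : z.re = 0) : ∃ t, z = sidePoint 0 t :=
  ⟨Real.log z.im, UpperHalfPlane.ext (Complex.ext (by simpa [sidePoint] using h)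
    (by simp [sidePoint, Real.exp_log z.im_pos]))⟩

/-! ### The modular group as a free product -/

section NormalForm

variable {G : Type*} [Group G] {b c : G}

/-- The products `b c^{e₁} b c^{e₂} ⋯ b c^{e_m}`, `m ≥ 1`, in which all the exponents but the last
one are nonzero modulo `3`. -/
inductive IsReducedWord (b c : G) : G → Prop
  | single (s : Fin 3) : IsReducedWord b c (b * c ^ (s : ℕ))
  | cons (s : Fin 3) (hs : s ≠ 0) (g : G) :
      IsReducedWord b c g → IsReducedWord b c (b * (c ^ (s : ℕ) * g))

theorem pow_eq_pow_fin (hc : c ^ 3 = 1) (m : ℕ) : ∃ s : Fin 3, c ^ m = c ^ (s : ℕ) :=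
  ⟨⟨m % 3, Nat.mod_lt _ (by norm_num)⟩, pow_eq_pow_mod m hc⟩

/-- A group generated by an involution `b` and an element `c` with `c ^ 3 = 1` consists of the
powers of `c` and of the products of a power of `c` with a reduced word. -/
theorem exists_reducedWord (hb : b ^ 2 = 1) (hc : c ^ 3 = 1)
    (hbc : Subgroup.closure {b, c} = ⊤) (g : G) :
    (∃ s : Fin 3, g = c ^ (s : ℕ)) ∨ ∃ (s : Fin 3) (w : G), IsReducedWord b c w ∧
      g = c ^ (s : ℕ) * w := by
  have hbb : b * b = 1 := by rwa [← pow_two]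
  have hmulC : ∀ (m : ℕ) (g : G), ((∃ s : Fin 3, g = c ^ (s : ℕ)) ∨ ∃ (s : Fin 3) (w : G),
      IsReducedWord b c w ∧ g = c ^ (s : ℕ) * w) → ((∃ s : Fin 3, c ^ m * g = c ^ (s : ℕ)) ∨
        ∃ (s : Fin 3) (w : G), IsReducedWord b c w ∧ c ^ m * g = c ^ (s : ℕ) * w) := by
    rintro m _ (⟨s, rfl⟩ | ⟨s, w, hw, rfl⟩)
    · rw [← pow_add]
      exact Or.inl (pow_eq_pow_fin hc _)
    · rw [← mul_assoc, ← pow_add]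
      obtain ⟨s', hs'⟩ := pow_eq_pow_fin hc (m + s)
      exact Or.inr ⟨s', w, hw, by rw [hs']⟩
  have hmulB : ∀ g : G, ((∃ s : Fin 3, g = c ^ (s : ℕ)) ∨ ∃ (s : Fin 3) (w : G),
      IsReducedWord b c w ∧ g = c ^ (s : ℕ) * w) → ((∃ s : Fin 3, b * g = c ^ (s : ℕ)) ∨
        ∃ (s : Fin 3) (w : G), IsReducedWord b c w ∧ b * g = c ^ (s : ℕ) * w) := by
    rintro _ (⟨s, rfl⟩ | ⟨s, w, hw, rfl⟩)
    · exact Or.inr ⟨0, _, .single s, by simp⟩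
    · by_cases hs : s = 0
      · subst hs
        -- the leading letter `b` of the word cancels
        cases hw with
        | single s => exact Or.inl ⟨s, by simp [← mul_assoc, hbb]⟩
        | cons s hs w hw => exact Or.inr ⟨s, w, hw, by simp [← mul_assoc, hbb]⟩
      · exact Or.inr ⟨0, _, .cons s hs w hw, by simp⟩
  have hg : g ∈ Subgroup.closure {b, c} := hbc ▸ Subgroup.mem_top g
  induction hg using Subgroup.closure_induction_left with
  | one => exact Or.inl ⟨0, by simp⟩
  | mul_left x hx y _ ih =>
    rcases hx with rfl | rfl
    · exact hmulB y ih
    · simpa using hmulC 1 y ih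
  | inv_mul_cancel x hx y _ ih =>
    rcases hx with rfl | rfl
    · rw [inv_eq_of_mul_eq_one_left hbb]
      exact hmulB y ih
    · rw [inv_eq_of_mul_eq_one_left (by rw [← hc, pow_succ x 2] : x ^ 2 * x = 1)]
      exact hmulC 2 y ih

/-- Ping-pong: `genB` exchanges the two sides of the imaginary axis, and nontrivial powers of `genC`
map the left side into the open right side. So a reduced word moves the ideal triangle to the
left side. -/
theorem re_reducedWord_smul {π : G →* PSL2Z} (hπb : π b = genB) (hπc : π c = genC) {w : G}
    (hw : IsReducedWord b c w) {z : ℍ} (hz : z ∈ idealTriangle) :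
    (π w • z).re < 0 ∨ ∃ s : Fin 3, w = b * c ^ (s : ℕ) ∧ (π w • z).re ≤ 0 := by
  induction hw with
  | single s =>
    refine Or.inr ⟨s, rfl, ?_⟩
    rw [map_mul, map_pow, hπb, hπc, mul_smul]
    exact re_genB_smul_nonpos (re_genC_pow_smul_nonneg hz _)
  | cons s hs w _ ih =>
    have : (π w • z).re ≤ 0 := ih.elim le_of_lt fun ⟨_, _, h⟩ => h
    rw [map_mul, map_mul, map_pow, hπb, hπc, mul_smul, mul_smul]
    exact Or.inl (re_genB_smul_neg (re_genC_pow_smul_pos this hs))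

/-- Two tiles of the Farey tessellation meet only if they are equal or have a side in common. This
is stated for any group that is generated by an involution `b` and an element `c` with `c ^ 3 = 1`
over the generators of `PSL(2, ℤ)`, so that it also shows that `PSL(2, ℤ)` is the free product of
the two cyclic groups. -/
theorem eq_of_mem_of_smul_mem {π : G →* PSL2Z} (hπb : π b = genB) (hπc : π c = genC)
    (hb : b ^ 2 = 1) (hc : c ^ 3 = 1) (hbc : Subgroup.closure {b, c} = ⊤) {g : G} {z : ℍ}
    (hz : z ∈ idealTriangle) (hgz : π g • z ∈ idealTriangle) :
    (∃ s : Fin 3, g = c ^ (s : ℕ)) ∨ ∃ s s' : Fin 3, g = (c ^ (s' : ℕ))⁻¹ * (b * c ^ (s : ℕ)) ∧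
      (genC ^ (s : ℕ) • z).re = 0 := by
  rcases exists_reducedWord hb hc hbc g with h | ⟨s', w, hw, rfl⟩
  · exact Or.inl h
  right
  have h3 : (c ^ (3 - s' : ℕ)) * c ^ (s' : ℕ) = 1 := by
    rw [← pow_add, Nat.sub_add_cancel s'.is_lt.le, hc]
  have hwz : 0 ≤ (π w • z).re := by
    have := re_genC_pow_smul_nonneg hgz (3 - s')
    rwa [← mul_smul, ← hπc, ← map_pow, ← map_mul, ← mul_assoc, h3, one_mul] at this
  rcases re_reducedWord_smul hπb hπc hw hz with h | ⟨s, rfl, h⟩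
  · exact absurd h hwz.not_gt
  · obtain ⟨s'', hs''⟩ := pow_eq_pow_fin hc (3 - s' : ℕ)
    refine ⟨s, s'', ?_, ?_⟩
    · rw [← hs'', eq_inv_of_mul_eq_one_right h3]
    · rw [map_mul, map_pow, hπb, hπc, mul_smul] at hwz
      exact le_antisymm (re_genB_smul_nonneg_iff.mp hwz) (re_genC_pow_smul_nonneg hz _)

/-- `PSL(2, ℤ)` has no relations between its generators other than `genB ^ 2 = 1` and
`genC ^ 3 = 1`. -/
theorem injective_of_map_generators {π : G →* PSL2Z} (hπb : π b = genB) (hπc : π c = genC)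
    (hb : b ^ 2 = 1) (hc : c ^ 3 = 1) (hbc : Subgroup.closure {b, c} = ⊤) :
    Function.Injective π := by
  rw [injective_iff_map_eq_one]
  intro g hg
  -- an interior point of the triangle that the rotation `genC` does not fix
  obtain ⟨z, hz⟩ : ∃ z : ℍ, (z : ℂ) = 1 / 2 + 2 * Complex.I :=
    ⟨⟨1 / 2 + 2 * Complex.I, by simp⟩, rfl⟩
  have hre : z.re = 1 / 2 := by rw [← UpperHalfPlane.coe_re, hz]; simp
  have him : z.im = 2 := by rw [← UpperHalfPlane.coe_im, hz]; simp
  have h1 : 0 < (genC • z).re := by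
    rw [← UpperHalfPlane.coe_re, coe_genC_smul, re_inv_pos_iff, hz]
    norm_num
  have h2 : genC ^ 2 • z ≠ z ∧ 0 < (genC ^ 2 • z).re := by
    have : (genC ^ 2 • z).re = 1 - 2 / 17 := by
      rw [← UpperHalfPlane.coe_re, coe_genC_sq_smul, hz]
      simp [Complex.inv_re, Complex.normSq_apply]
      norm_num
    refine ⟨fun h => ?_, by rw [this]; norm_num⟩
    rw [h, hre] at this
    norm_num at this
  have hT : z ∈ idealTriangle := mem_idealTriangle_iff.mpr ⟨by rw [hre]; norm_num, h1.le, h2.2.le⟩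
  have hC : genC • z ≠ z := fun h => h2.1 (by rw [pow_two, mul_smul, h, h])
  rcases eq_of_mem_of_smul_mem hπb hπc hb hc hbc hT (g := g) (by rwa [hg, one_smul]) with
    ⟨s, rfl⟩ | ⟨s, s', rfl, h⟩
  · rw [map_pow, hπc] at hg
    fin_cases s
    · simp
    · exact absurd (by simpa using congrArg (· • z) hg) hC
    · exact absurd (by simpa using congrArg (· • z) hg) h2.1
  · fin_cases s
    · simp [hre] at h
    · simp [h1.ne'] at h
    · simp [h2.2.ne'] at h

end NormalForm

/-- The case of `PSL(2, ℤ)` itself of `eq_of_mem_of_smul_mem`. -/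
theorem genC_pow_or_of_smul_mem {γ : PSL2Z} {z : ℍ} (hz : z ∈ idealTriangle)
    (hγz : γ • z ∈ idealTriangle) :
    (∃ s : Fin 3, γ = genC ^ (s : ℕ)) ∨ ∃ s s' : Fin 3,
      γ = (genC ^ (s' : ℕ))⁻¹ * (genB * genC ^ (s : ℕ)) ∧ (genC ^ (s : ℕ) • z).re = 0 :=
  eq_of_mem_of_smul_mem (π := MonoidHom.id PSL2Z) rfl rfl genB_sq genC_pow_three
    closure_genB_genC hz hγz

/-- The universal property of `PSL(2, ℤ)` as a free product of cyclic groups of orders two and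
three. The homomorphism is the one whose graph is generated by `(genB, x)` and `(genC, y)`. -/
theorem existsUnique_hom {H : Type*} [Group H] {x y : H} (hx : x ^ 2 = 1) (hy : y ^ 3 = 1) :
    ∃! Φ : PSL2Z →* H, Φ genB = x ∧ Φ genC = y := by
  set Γ : Subgroup (PSL2Z × H) := Subgroup.closure {(genB, x), (genC, y)} with hΓ
  let b : Γ := ⟨(genB, x), Subgroup.subset_closure (by simp)⟩
  let c : Γ := ⟨(genC, y), Subgroup.subset_closure (by simp)⟩
  let π : Γ →* PSL2Z := (MonoidHom.fst PSL2Z H).comp Γ.subtype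
  have hinj : Function.Injective π := by
    refine injective_of_map_generators (b := b) (c := c) rfl rfl
      (Subtype.ext (Prod.ext genB_sq hx)) (Subtype.ext (Prod.ext genC_pow_three hy)) ?_
    have := Subgroup.closure_closure_coe_preimage (k := {(genB, x), (genC, y)})
    convert this using 2
    ext ⟨p, hp⟩
    simp [b, c]
  have hsurj : Function.Surjective π := by
    rw [← MonoidHom.range_eq_top, eq_top_iff, ← closure_genB_genC, Subgroup.closure_le]
    rintro _ (rfl | rfl)
    exacts [⟨b, rfl⟩, ⟨c, rfl⟩]
  let e : Γ ≃* PSL2Z := MulEquiv.ofBijective π ⟨hinj, hsurj⟩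
  have heb : e.symm genB = b := e.symm_apply_eq.mpr rfl
  have hec : e.symm genC = c := e.symm_apply_eq.mpr rfl
  refine ⟨((MonoidHom.snd PSL2Z H).comp Γ.subtype).comp e.symm.toMonoidHom, ⟨?_, ?_⟩, ?_⟩
  · change (e.symm genB : PSL2Z × H).2 = x
    rw [heb]
  · change (e.symm genC : PSL2Z × H).2 = y
    rw [hec]
  · rintro Ψ ⟨hb, hc⟩
    refine MonoidHom.eq_of_eqOn_dense closure_genB_genC ?_
    rintro _ (rfl | rfl)
    · change _ = (e.symm genB : PSL2Z × H).2
      rw [heb, hb]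
    · change _ = (e.symm genC : PSL2Z × H).2
      rw [hec, hc]

/-! ### The Farey tessellation -/

theorem exists_smul_mem_idealTriangle (z : ℍ) : ∃ γ : PSL2Z, γ • z ∈ idealTriangle := by
  obtain ⟨g, hn, hre⟩ := ModularGroup.exists_smul_mem_fd z
  rw [Complex.normSq_apply, UpperHalfPlane.coe_re, UpperHalfPlane.coe_im] at hn
  rw [abs_le] at hre
  rcases le_total 0 (g • z).re with h | h
  · refine ⟨QuotientGroup.mk g, ?_⟩
    rw [mk_smul]
    exact ⟨h, by linarith, by nlinarith⟩
  · refine ⟨QuotientGroup.mk (ModularGroup.T * g), ?_⟩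
    rw [mk_smul, mul_smul, UpperHalfPlane.modular_T_smul]
    refine ⟨?_, ?_, ?_⟩ <;>
      simp only [UpperHalfPlane.vadd_re, UpperHalfPlane.vadd_im] <;> nlinarith

/-- The tessellation is locally finite: finitely many tiles cover a neighbourhood of `z`, all of
them containing `z`. -/
theorem exists_finite_eventually_mem_idealTriangle (z : ℍ) :
    ∃ F : Set PSL2Z, F.Finite ∧
      ∀ᶠ w in 𝓝 z, ∃ δ ∈ F, δ • z ∈ idealTriangle ∧ δ • w ∈ idealTriangle := by
  obtain ⟨δ, hδ⟩ := exists_smul_mem_idealTriangle z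
  have hcont : ∀ γ : PSL2Z, Continuous fun w : ℍ => (γ • w).re := fun γ =>
    UpperHalfPlane.continuous_re.comp (continuous_const_smul γ)
  by_cases hside : ∃ s : ℕ, (genC ^ s • δ • z).re = 0
  · obtain ⟨s, hs⟩ := hside
    obtain ⟨ε, hε⟩ : ∃ ε : PSL2Z, ε = genC ^ s * δ := ⟨_, rfl⟩
    have hεz : ε • z ∈ idealTriangle := by
      rw [hε, mul_smul]; exact genC_pow_smul_mem hδ s
    have hε0 : (ε • z).re = 0 := by rw [hε, mul_smul, hs]
    have hBε0 : (genB • ε • z).re = 0 :=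
      le_antisymm (re_genB_smul_nonpos hε0.ge) (re_genB_smul_nonneg_iff.mpr hε0.le)
    have hBεz : (genB * ε) • z ∈ idealTriangle := by
      rw [mul_smul, mem_idealTriangle_iff]
      exact ⟨hBε0.ge, (re_genC_smul_pos hBε0.le).le, (re_genC_sq_smul_pos hBε0.le).le⟩
    refine ⟨{ε, genB * ε}, by simp, ?_⟩
    have key : ∀ γ : PSL2Z, (γ • z).re = 0 → ∀ᶠ w in 𝓝 z,
        0 < (genC • γ • w).re ∧ 0 < (genC ^ 2 • γ • w).re := by
      intro γ hγ
      have h1 := (hcont (genC * γ)).tendsto z |>.eventually_const_lt (u := 0)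
        (by rw [mul_smul]; exact re_genC_smul_pos hγ.le)
      have h2 := (hcont (genC ^ 2 * γ)).tendsto z |>.eventually_const_lt (u := 0)
        (by rw [mul_smul]; exact re_genC_sq_smul_pos hγ.le)
      simp only [mul_smul] at h1 h2
      exact h1.and h2
    filter_upwards [key ε hε0, key (genB * ε) (by rw [mul_smul, hBε0])] with w hw hBw
    rcases le_total 0 (ε • w).re with h | h
    · exact ⟨ε, by simp, hεz, mem_idealTriangle_iff.mpr ⟨h, hw.1.le, hw.2.le⟩⟩
    · refine ⟨genB * ε, by simp, hBεz, mem_idealTriangle_iff.mpr ⟨?_, hBw.1.le, hBw.2.le⟩⟩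
      rw [mul_smul]
      exact re_genB_smul_nonneg_iff.mpr h
  · push Not at hside
    have key : ∀ s : ℕ, ∀ᶠ w in 𝓝 z, 0 < (genC ^ s • δ • w).re := by
      intro s
      have := (hcont (genC ^ s * δ)).tendsto z |>.eventually_const_lt (u := 0) (by
        rw [mul_smul]
        exact lt_of_le_of_ne (re_genC_pow_smul_nonneg hδ s) (hside s).symm)
      simpa only [mul_smul] using this
    refine ⟨{δ}, by simp, ?_⟩
    filter_upwards [key 0, key 1, key 2] with w h0 h1 h2
    rw [pow_zero, one_smul] at h0
    rw [pow_one] at h1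
    exact ⟨δ, rfl, hδ, mem_idealTriangle_iff.mpr ⟨h0.le, h1.le, h2.le⟩⟩

/-- `PSL(2, ℤ)` acts properly discontinuously: points of the orbit of `x` other than `x` stay away
from `x`. -/
theorem exists_le_dist_smul (x : ℍ) :
    ∃ ε > 0, ∀ γ : PSL2Z, γ ∉ MulAction.stabilizer PSL2Z x → ε ≤ dist x (γ • x) := by
  obtain ⟨F, hF, hev⟩ := exists_finite_eventually_mem_idealTriangle x
  obtain ⟨r, hr, hball⟩ := Metric.eventually_nhds_iff.mp hev
  -- the elements that move the triangle to itself or to a neighbour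
  let K : Set PSL2Z := Set.range (fun s : Fin 3 => genC ^ (s : ℕ)) ∪
    Set.range fun p : Fin 3 × Fin 3 => (genC ^ (p.2 : ℕ))⁻¹ * (genB * genC ^ (p.1 : ℕ))
  have hK : K.Finite := (Set.finite_range _).union (Set.finite_range _)
  let N : Set PSL2Z := (fun q : PSL2Z × PSL2Z => q.1⁻¹ * q.2 * q.1) '' (F ×ˢ K)
  have hN : N.Finite := (hF.prod hK).image _
  have hnear : ∀ γ : PSL2Z, dist (γ • x) x < r → γ ∈ N := by
    intro γ hγ
    obtain ⟨δ, hδ, h1, h2⟩ := hball hγ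
    refine ⟨(δ, δ * γ * δ⁻¹), ⟨hδ, ?_⟩, by simp [mul_assoc]⟩
    have h3 : (δ * γ * δ⁻¹) • δ • x ∈ idealTriangle := by
      simpa [mul_smul] using h2
    rcases genC_pow_or_of_smul_mem h1 h3 with ⟨s, hs⟩ | ⟨s, s', hs, -⟩
    · exact Or.inl ⟨s, hs.symm⟩
    · exact Or.inr ⟨(s, s'), hs.symm⟩
  -- a finite set of positive distances has a positive lower bound
  have hmin : ∀ M : Set PSL2Z, M.Finite → ∃ ε > 0, ∀ γ ∈ M, γ ∉ MulAction.stabilizer PSL2Z x →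
      ε ≤ dist x (γ • x) := by
    intro M hM
    induction M, hM using Set.Finite.induction_on with
    | empty => exact ⟨1, one_pos, by simp⟩
    | @insert γ M _ _ ih =>
      obtain ⟨ε, hε, h⟩ := ih
      by_cases hγ : γ ∈ MulAction.stabilizer PSL2Z x
      · refine ⟨ε, hε, ?_⟩
        rintro γ' (rfl | hγ') hn
        exacts [absurd hγ hn, h γ' hγ' hn]
      · refine ⟨min ε (dist x (γ • x)), lt_min hε (dist_pos.mpr fun e => hγ ?_), ?_⟩
        · exact MulAction.mem_stabilizer_iff.mpr e.symm
        · rintro γ' (rfl | hγ') hn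
          exacts [min_le_right _ _, (min_le_left _ _).trans (h γ' hγ' hn)]
  obtain ⟨ε, hε, h⟩ := hmin N hN
  refine ⟨min ε r, lt_min hε hr, fun γ hγ => ?_⟩
  by_cases hd : dist (γ • x) x < r
  · exact (min_le_left _ _).trans (h γ (hnear γ hd) hγ)
  · rw [dist_comm]
    exact (min_le_right _ _).trans (not_lt.mp hd)

/-- An element of `PSL(2, ℤ)` with a fixed point in `ℍ` is conjugate to a power of `genC` or to
`genB`. -/
theorem exists_conj_eq_of_smul_eq {γ : PSL2Z} {x : ℍ} (h : γ • x = x) :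
    ∃ δ : PSL2Z, (∃ s : Fin 3, δ * γ * δ⁻¹ = genC ^ (s : ℕ)) ∨ δ * γ * δ⁻¹ = genB := by
  obtain ⟨δ, hδ⟩ := exists_smul_mem_idealTriangle x
  have hfix : (δ * γ * δ⁻¹) • δ • x = δ • x := by simp [mul_smul, h]
  rcases genC_pow_or_of_smul_mem hδ (by rwa [hfix]) with ⟨s, hs⟩ | ⟨s, s', hs, h0⟩
  · exact ⟨δ, Or.inl ⟨s, hs⟩⟩
  · refine ⟨genC ^ (s : ℕ) * δ, Or.inr ?_⟩
    have hconj : genC ^ (s : ℕ) * δ * γ * (genC ^ (s : ℕ) * δ)⁻¹ =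
        genC ^ (s : ℕ) * (genC ^ (s' : ℕ))⁻¹ * genB := by
      calc _ = genC ^ (s : ℕ) * (δ * γ * δ⁻¹) * (genC ^ (s : ℕ))⁻¹ := by group
        _ = _ := by rw [hs]; group
    rw [hconj]
    -- the conjugate fixes a point of the imaginary axis, so no power of `genC` remains
    obtain ⟨w, hw⟩ : ∃ w : ℍ, w = genC ^ (s : ℕ) • δ • x := ⟨_, rfl⟩
    rw [← hw] at h0
    have hfixw : (genC ^ (s : ℕ) * (genC ^ (s' : ℕ))⁻¹ * genB) • w = w := by
      rw [← hconj, hw]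
      simp [mul_smul, h]
    have h3 : (genC ^ (s' : ℕ))⁻¹ = genC ^ (3 - s' : ℕ) := by
      rw [inv_eq_iff_mul_eq_one, ← pow_add, Nat.add_sub_cancel' s'.is_lt.le, genC_pow_three]
    rw [h3, ← pow_add] at hfixw ⊢
    obtain ⟨e, he⟩ := pow_eq_pow_fin genC_pow_three (s + (3 - s') : ℕ)
    rw [he] at hfixw ⊢
    by_cases he0 : e = 0
    · simp [he0]
    · have := re_genC_pow_smul_pos (re_genB_smul_nonpos h0.ge) he0
      rw [← mul_smul, hfixw, h0] at this
      exact absurd this (lt_irrefl _)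

/-! ### Geodesics of the hyperbolic plane -/

/-- The parametrization by arc length of the semicircle with centre `a` and radius `R`. -/
theorem isometry_semicircle (a : ℝ) {R : ℝ} (hR : 0 < R) :
    Isometry fun s : ℝ => (⟨⟨a + R * (Real.sinh s / Real.cosh s), R / Real.cosh s⟩,
      div_pos hR (Real.cosh_pos s)⟩ : ℍ) := by
  refine Isometry.of_dist_eq fun s t => ?_
  have hs := Real.cosh_pos s
  have ht := Real.cosh_pos t
  have h : Real.cosh (dist (⟨⟨a + R * (Real.sinh s / Real.cosh s), R / Real.cosh s⟩,
      div_pos hR (Real.cosh_pos s)⟩ : ℍ) ⟨⟨a + R * (Real.sinh t / Real.cosh t), R / Real.cosh t⟩,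
      div_pos hR (Real.cosh_pos t)⟩) = Real.cosh (dist s t) := by
    rw [Real.dist_eq, Real.cosh_abs, Real.cosh_sub, UpperHalfPlane.cosh_dist']
    simp only [UpperHalfPlane.mk_re, UpperHalfPlane.mk_im]
    field_simp
    have e1 := Real.sinh_sq s
    have e2 := Real.sinh_sq t
    ring_nf
    rw [e1, e2]
    ring
  exact Real.cosh_strictMonoOn.injOn dist_nonneg dist_nonneg h

/-- Any two points of the hyperbolic plane lie on a geodesic line: a vertical line or a semicircle
with centre on the real axis. -/
theorem exists_geodesic (z w : ℍ) :
    ∃ (c : ℝ → ℍ) (a b : ℝ), Isometry c ∧ c a = z ∧ c b = w := by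
  by_cases hre : z.re = w.re
  · refine ⟨_, Real.log z.im, Real.log w.im, UpperHalfPlane.isometry_vertical_line z.re, ?_, ?_⟩
    · exact UpperHalfPlane.ext (Complex.ext rfl (Real.exp_log z.im_pos))
    · exact UpperHalfPlane.ext (Complex.ext hre (Real.exp_log w.im_pos))
  · -- the centre `a` of the semicircle is at the same Euclidean distance from `z` and `w`
    obtain ⟨a, ha⟩ : ∃ a : ℝ, (z.re - a) ^ 2 + z.im ^ 2 = (w.re - a) ^ 2 + w.im ^ 2 := by
      have : w.re - z.re ≠ 0 := sub_ne_zero.mpr (Ne.symm hre)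
      refine ⟨(w.re ^ 2 + w.im ^ 2 - z.re ^ 2 - z.im ^ 2) / (2 * (w.re - z.re)), ?_⟩
      field_simp
      ring
    have hz := z.im_pos
    have hpos : 0 < (z.re - a) ^ 2 + z.im ^ 2 := by positivity
    obtain ⟨R, hR, hR2⟩ : ∃ R : ℝ, 0 < R ∧ R ^ 2 = (z.re - a) ^ 2 + z.im ^ 2 :=
      ⟨_, Real.sqrt_pos.mpr hpos, Real.sq_sqrt hpos.le⟩
    have key : ∀ u : ℍ, (u.re - a) ^ 2 + u.im ^ 2 = R ^ 2 → ∃ s : ℝ,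
        (⟨⟨a + R * (Real.sinh s / Real.cosh s), R / Real.cosh s⟩,
          div_pos hR (Real.cosh_pos s)⟩ : ℍ) = u := by
      intro u hu
      have hu0 := u.im_pos
      have hs : Real.sinh (Real.arsinh ((u.re - a) / u.im)) = (u.re - a) / u.im :=
        Real.sinh_arsinh _
      have hc : Real.cosh (Real.arsinh ((u.re - a) / u.im)) = R / u.im := by
        rw [Real.cosh_arsinh, Real.sqrt_eq_iff_mul_self_eq (by positivity) (by positivity)]
        field_simp
        linarith
      refine ⟨Real.arsinh ((u.re - a) / u.im), UpperHalfPlane.ext (Complex.ext ?_ ?_)⟩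
      · change a + R * (_ / _) = u.re
        rw [hs, hc]
        field_simp
        ring
      · change R / _ = u.im
        rw [hc]
        field_simp
    obtain ⟨s, hs⟩ := key z hR2.symm
    obtain ⟨t, ht⟩ := key w (by rw [hR2, ha])
    exact ⟨_, s, t, isometry_semicircle a hR, hs, ht⟩

/-- A curve that moves away from each of its points at most at unit speed, near that point, is
`1`-Lipschitz. -/
theorem edist_le_of_eventually_edist_le {Y : Type*} [PseudoEMetricSpace Y] {f : ℝ → Y}
    (h : ∀ t, ∀ᶠ s in 𝓝 t, edist (f t) (f s) ≤ edist t s) (a b : ℝ) :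
    edist (f a) (f b) ≤ edist a b := by
  wlog hab : a ≤ b generalizing a b
  · rw [edist_comm, edist_comm a]
    exact this b a (le_of_not_ge hab)
  have hcont : Continuous f := by
    refine continuous_iff_continuousAt.mpr fun t => ?_
    rw [ContinuousAt, tendsto_iff_edist_tendsto_0]
    have h0 : Filter.Tendsto (fun s => edist s t) (𝓝 t) (𝓝 0) :=
      tendsto_iff_edist_tendsto_0.mp Filter.tendsto_id
    refine tendsto_of_tendsto_of_tendsto_of_le_of_le' tendsto_const_nhds h0
      (Filter.Eventually.of_forall fun _ => zero_le) ?_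
    filter_upwards [h t] with s hs
    rwa [edist_comm, edist_comm s]
  have hsub : Set.Icc a b ⊆ {t | edist (f a) (f t) ≤ edist a t} := by
    refine IsClosed.Icc_subset_of_forall_mem_nhdsWithin ?_ (by simp) ?_
    · exact (isClosed_le (by fun_prop) (by fun_prop)).inter isClosed_Icc
    · rintro t ⟨ht, hat, -⟩
      have ht' : ∀ᶠ s in 𝓝[>] t, edist (f t) (f s) ≤ edist t s :=
        (h t).filter_mono nhdsWithin_le_nhds
      filter_upwards [ht', self_mem_nhdsWithin] with s hs hts
      have hts : t < s := hts
      calc edist (f a) (f s) ≤ edist (f a) (f t) + edist (f t) (f s) := edist_triangle _ _ _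
        _ ≤ edist a t + edist t s := add_le_add ht hs
        _ = edist a s := by
          rw [edist_dist, edist_dist, edist_dist, ← ENNReal.ofReal_add dist_nonneg dist_nonneg,
            Real.dist_eq, Real.dist_eq, Real.dist_eq, abs_of_nonpos (sub_nonpos.mpr hat),
            abs_of_neg (sub_neg.mpr hts), abs_of_neg (sub_neg.mpr (hat.trans_lt hts))]
          congr 1
          ring
  exact hsub ⟨hab, le_rfl⟩

/-- The same for maps out of the hyperbolic plane, by restriction to geodesics. -/
theorem edist_le_of_eventually_edist_le_upperHalfPlane {Y : Type*} [PseudoEMetricSpace Y]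
    {f : ℍ → Y} (h : ∀ z, ∀ᶠ w in 𝓝 z, edist (f z) (f w) ≤ edist z w) (z w : ℍ) :
    edist (f z) (f w) ≤ edist z w := by
  obtain ⟨c, a, b, hc, rfl, rfl⟩ := exists_geodesic z w
  rw [hc a b]
  refine edist_le_of_eventually_edist_le (f := f ∘ c) (fun t => ?_) a b
  filter_upwards [hc.continuous.continuousAt.eventually (h (c t))] with s hs
  rwa [hc t s] at hs

/-! ### Quotient metrics -/

theorem Copies.edist_same {ι X : Type*} [PseudoEMetricSpace X] (i : ι) (a b : X) :
    edist (⟨i, a⟩ : Copies ι X) ⟨i, b⟩ = edist a b := if_pos rfl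

theorem Copies.edist_of_ne {ι X : Type*} [PseudoEMetricSpace X] {i j : ι} (h : i ≠ j) (a b : X) :
    edist (⟨i, a⟩ : Copies ι X) ⟨j, b⟩ = ⊤ := if_neg h

namespace MetricQuotient

variable {X Y : Type*} [PseudoEMetricSpace X] [PseudoEMetricSpace Y] {s : Setoid X}

theorem le_edist_iff {x y : MetricQuotient s} {d : ℝ≥0∞} :
    d ≤ edist x y ↔ ∀ l, QuotientChain s x y l → d ≤ l :=
  le_iInf₂_iff

theorem edist_le_of_chain {x y : MetricQuotient s} {l : ℝ≥0∞} (h : QuotientChain s x y l) :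
    edist x y ≤ l :=
  iInf₂_le l h

theorem edist_mk_mk_le (a b : X) : edist (mk s a) (mk s b) ≤ edist a b := by
  have := edist_le_of_chain (QuotientChain.step a b _ 0 (QuotientChain.refl (Quotient.mk s b)))
  rwa [add_zero] at this

/-- A map out of a metric quotient is `1`-Lipschitz as soon as its composition with the projection
is. -/
theorem edist_map_le {f : MetricQuotient s → Y}
    (h : ∀ a b, edist (f (mk s a)) (f (mk s b)) ≤ edist a b) (x y : MetricQuotient s) :
    edist (f x) (f y) ≤ edist x y := by
  rw [le_edist_iff]
  intro l hl
  induction hl with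
  | refl x => exact (edist_self _).le
  | step a b y l _ ih => exact (edist_triangle _ _ _).trans (add_le_add (h a b) ih)

/-- If the classes of the relation are permuted by isometries, then chains lift: a chain of length
`l` that starts at the class of `a` ends at the class of a point at distance at most `l` from
`a`. -/
theorem exists_edist_le_of_chain
    (hs : ∀ a a' b, s.r a a' → ∃ b', s.r b b' ∧ edist a' b' = edist a b) {x y : MetricQuotient s}
    {l : ℝ≥0∞} (h : QuotientChain s x y l) {a : X} (ha : mk s a = x) :
    ∃ b, mk s b = y ∧ edist a b ≤ l := by
  induction h generalizing a with
  | refl x => exact ⟨a, ha, (edist_self a).le⟩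
  | step a₀ b₀ y l _ ih =>
    obtain ⟨b', hb', hd⟩ := hs a₀ a b₀ (Quotient.exact ha.symm)
    obtain ⟨b, hb, hdb⟩ := ih (Quotient.sound hb').symm
    exact ⟨b, hb, (edist_triangle a b' b).trans (add_le_add hd.le hdb)⟩

theorem surjective_mk : Function.Surjective (mk s) := Quotient.mk_surjective

theorem continuous_mk : Continuous (mk s) :=
  LipschitzWith.continuous (K := 1) fun a b => by simpa using edist_mk_mk_le a b

theorem isOpenMap_mk (hs : ∀ a a' b, s.r a a' → ∃ b', s.r b b' ∧ edist a' b' = edist a b) :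
    IsOpenMap (mk s) := by
  refine isOpenMap_iff_nhds_le.mpr fun a => ?_
  refine (Filter.HasBasis.le_basis_iff Metric.nhds_basis_eball
    (Metric.nhds_basis_eball.map _)).mpr fun ε hε => ⟨ε, hε, fun y hy => ?_⟩
  rw [Metric.mem_eball'] at hy
  obtain ⟨l, hl⟩ := iInf_lt_iff.mp hy
  obtain ⟨hc, hlt⟩ := iInf_lt_iff.mp hl
  obtain ⟨b, rfl, hb⟩ := exists_edist_le_of_chain hs hc rfl
  exact ⟨b, Metric.mem_eball'.mpr (hb.trans_lt hlt), rfl⟩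

end MetricQuotient

/-! ### The quotient of `ℍ × [N]` -/

section Twisted

variable {N : ℕ} {Φ : PSL2Z →* Equiv.Perm (Fin N)}

theorem twistedOrbitRel_iff {p q : Copies (Fin N) ℍ} :
    (twistedOrbitRel Φ).r p q ↔ ∃ γ : PSL2Z, (⟨Φ γ q.idx, γ • q.pt⟩ : Copies (Fin N) ℍ) = p :=
  Iff.rfl

theorem mk_twisted_eq_iff {i j : Fin N} {z w : ℍ} :
    MetricQuotient.mk (twistedOrbitRel Φ) ⟨i, z⟩ = MetricQuotient.mk (twistedOrbitRel Φ) ⟨j, w⟩ ↔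
      ∃ γ : PSL2Z, Φ γ j = i ∧ γ • w = z :=
  Quotient.eq.trans (twistedOrbitRel_iff.trans (by simp [Copies.ext_iff]))

theorem twistedOrbitRel_isometric (a a' b : Copies (Fin N) ℍ) (h : (twistedOrbitRel Φ).r a a') :
    ∃ b', (twistedOrbitRel Φ).r b b' ∧ edist a' b' = edist a b := by
  obtain ⟨γ, rfl⟩ := twistedOrbitRel_iff.mp h
  refine ⟨⟨Φ γ⁻¹ b.idx, γ⁻¹ • b.pt⟩, twistedOrbitRel_iff.mpr ⟨γ, ?_⟩, ?_⟩
  · simp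
  · obtain ⟨i, z⟩ := a'
    obtain ⟨j, w⟩ := b
    by_cases hij : Φ γ i = j
    · subst hij
      have : Φ γ⁻¹ (Φ γ i) = i := by simp
      rw [this, Copies.edist_same, Copies.edist_same, ← edist_smul_left γ, smul_inv_smul]
    · rw [Copies.edist_of_ne hij, Copies.edist_of_ne]
      rintro rfl
      exact hij (by simp)

theorem isOpenMap_mk_twisted : IsOpenMap (MetricQuotient.mk (twistedOrbitRel Φ)) :=
  MetricQuotient.isOpenMap_mk twistedOrbitRel_isometric

theorem isQuotientMap_mk_twisted :
    Topology.IsQuotientMap (MetricQuotient.mk (twistedOrbitRel Φ)) :=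
  isOpenMap_mk_twisted.isQuotientMap MetricQuotient.continuous_mk
    MetricQuotient.surjective_mk

end Twisted

/-! ### Free actions on finite sets -/

/-- A free action on a finite set identifies the set with a finite number of copies of the
group. -/
theorem exists_bijective_of_free {H X : Type*} [Group H] [MulAction H X] [Finite X]
    (hfree : ∀ (h : H) (x : X), h • x = x → h = 1) :
    ∃ (m : ℕ) (r : Fin m → X), Function.Bijective fun q : Fin m × H => q.2 • r q.1 := by
  have : Finite (MulAction.orbitRel.Quotient H X) := Quotient.finite _
  obtain ⟨m, ⟨e⟩⟩ := Finite.exists_equiv_fin (MulAction.orbitRel.Quotient H X)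
  refine ⟨m, fun j => Quotient.out (e.symm j), ?_, ?_⟩
  · rintro ⟨j, h⟩ ⟨j', h'⟩ (heq : h • Quotient.out (e.symm j) = h' • Quotient.out (e.symm j'))
    have hj : j = j' := by
      have : (Quotient.mk (MulAction.orbitRel H X) (Quotient.out (e.symm j))) =
          Quotient.mk (MulAction.orbitRel H X) (Quotient.out (e.symm j')) :=
        Quotient.sound ⟨h⁻¹ * h', by
          change (h⁻¹ * h') • Quotient.out (e.symm j') = _
          rw [mul_smul, ← heq, inv_smul_smul]⟩
      rw [Quotient.out_eq, Quotient.out_eq] at this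
      exact e.symm.injective this
    subst hj
    have := hfree (h'⁻¹ * h) _ (by rw [mul_smul, heq, inv_smul_smul])
    rw [inv_mul_eq_one.mp this]
  · intro x
    obtain ⟨h, hh⟩ := Quotient.mk_out (s := MulAction.orbitRel H X) x
    refine ⟨(e (Quotient.mk _ x), h⁻¹), ?_⟩
    change h⁻¹ • Quotient.out (e.symm (e _)) = x
    rw [e.symm_apply_apply, ← hh]
    exact inv_smul_smul h x

theorem pow_apply_ne {α : Type*} {τ : Equiv.Perm α} (h3 : τ ^ 3 = 1) (hτ : ∀ i, τ i ≠ i)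
    {s : Fin 3} (hs : s ≠ 0) (i : α) : (τ ^ (s : ℕ)) i ≠ i := by
  fin_cases s
  · exact absurd rfl hs
  · simpa using hτ i
  · intro h
    have h' : (τ ^ 3) i = τ ((τ ^ 2) i) := by rw [pow_succ', Equiv.Perm.mul_apply]
    rw [h3, show (τ ^ 2) i = i from h] at h'
    exact hτ i h'.symm

theorem nonempty_triangleLabelling {n : ℕ} {τ : Equiv.Perm (Fin (6 * n))} (h3 : orderOf τ = 3)
    (hτ : ∀ i, τ i ≠ i) : Nonempty (TriangleLabelling n τ) := by
  have hτ3 : τ ^ 3 = 1 := by rw [← h3, pow_orderOf_eq_one]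
  have hpow : ∀ h : Subgroup.zpowers τ, ∃ s : Fin 3, (h : Equiv.Perm _) = τ ^ (s : ℕ) := by
    rintro ⟨_, hh⟩
    obtain ⟨k, rfl⟩ := mem_zpowers_iff_mem_range_orderOf.mp hh |> Finset.mem_image.mp |>.imp
      fun _ h => h.2.symm
    exact pow_eq_pow_fin hτ3 k
  obtain ⟨m, r, hinj, hsurj⟩ := exists_bijective_of_free (H := Subgroup.zpowers τ)
    (X := Fin (6 * n)) (by
      intro h i hi
      obtain ⟨s, hs⟩ := hpow h
      by_cases hs0 : s = 0
      · exact Subtype.ext (by rw [hs, hs0]; simp)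
      · have : (h : Equiv.Perm _) i = i := hi
        rw [hs] at this
        exact absurd this (pow_apply_ne hτ3 hτ hs0 i))
  have hbij : Function.Bijective fun q : Fin m × Fin 3 => (τ ^ (q.2 : ℕ)) (r q.1) := by
    constructor
    · rintro ⟨k, s⟩ ⟨k', s'⟩ h
      have := @hinj (k, ⟨τ ^ (s : ℕ), Subgroup.npow_mem_zpowers τ s⟩)
        (k', ⟨τ ^ (s' : ℕ), Subgroup.npow_mem_zpowers τ s'⟩) h
      simp only [Prod.mk.injEq, Subtype.mk.injEq] at this
      exact Prod.ext this.1 (Fin.ext (pow_injOn_Iio_orderOf (by simp [h3]) (by simp [h3]) this.2))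
    · intro i
      obtain ⟨⟨k, h⟩, hk⟩ := hsurj i
      obtain ⟨s, hs⟩ := hpow h
      exact ⟨(k, s), by rw [← hk]; change _ = (h : Equiv.Perm _) (r k); rw [hs]⟩
  have hm : m = 2 * n := by
    have := Nat.card_congr (Equiv.ofBijective _ hbij)
    simp at this
    omega
  subst hm
  refine ⟨⟨Equiv.ofBijective _ hbij, fun k s => ?_⟩⟩
  change (τ ^ ((s + 1 : Fin 3) : ℕ)) (r k) = τ ((τ ^ (s : ℕ)) (r k))
  rw [← Equiv.Perm.mul_apply, ← pow_succ', pow_eq_pow_mod (s + 1 : ℕ) hτ3, Fin.val_add]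
  rfl

/-! ### The orbifold covering -/

section Covering

variable {n : ℕ} {σ τ : Equiv.Perm (Fin (6 * n))} {Φ : PSL2Z →* Equiv.Perm (Fin (6 * n))}

/-- Local groups of the modular surface act freely on the sheets, since elliptic elements are
conjugate to powers of the generators. -/
theorem eq_one_of_smul_eq_of_apply_eq (hσ : ∀ i, σ i ≠ i) (h3 : τ ^ 3 = 1) (hτ : ∀ i, τ i ≠ i)
    (hB : Φ genB = σ) (hC : Φ genC = τ) {γ : PSL2Z} {x : ℍ} {i : Fin (6 * n)} (hx : γ • x = x)
    (hi : Φ γ i = i) : γ = 1 := by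
  obtain ⟨δ, h⟩ := exists_conj_eq_of_smul_eq hx
  have hfix : Φ (δ * γ * δ⁻¹) (Φ δ i) = Φ δ i := by simp [hi]
  rcases h with ⟨s, hs⟩ | hs
  · by_cases hs0 : s = 0
    · rw [hs0] at hs
      simpa using hs
    · rw [hs, map_pow, hC] at hfix
      exact absurd hfix (pow_apply_ne h3 hτ hs0 _)
  · rw [hs, hB] at hfix
    exact absurd hfix (hσ _)

theorem isOrbifoldCoveringSurface_twistedProj (hn : 1 ≤ n) (hσ : ∀ i, σ i ≠ i) (h3 : τ ^ 3 = 1)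
    (hτ : ∀ i, τ i ≠ i) (hB : Φ genB = σ) (hC : Φ genC = τ) :
    IsOrbifoldCoveringSurface (twistedProj Φ) (6 * n) := by
  intro x
  obtain ⟨ε, hε, hεx⟩ := exists_le_dist_smul x
  have hfree : ∀ γ ∈ MulAction.stabilizer PSL2Z x, ∀ i, Φ γ i = i → γ = 1 := fun γ hγ i hi =>
    eq_one_of_smul_eq_of_apply_eq hσ h3 hτ hB hC hγ hi
  have hfin : Finite (MulAction.stabilizer PSL2Z x) := by
    let i₀ : Fin (6 * n) := ⟨0, by omega⟩
    refine Finite.of_injective (fun γ : MulAction.stabilizer PSL2Z x => Φ γ i₀) ?_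
    intro γ γ' (h : Φ γ i₀ = Φ γ' i₀)
    have := hfree _ (γ'⁻¹ * γ).2 i₀ (by
      rw [Subgroup.coe_mul, Subgroup.coe_inv, map_mul, Equiv.Perm.mul_apply, h]
      simp)
    exact (inv_mul_eq_one.mp (Subtype.ext this)).symm
  have hstab : ∀ γ : PSL2Z, ∀ a ∈ Metric.ball x (ε / 4), ∀ b ∈ Metric.ball x (ε / 4),
      dist a (γ • b) < ε / 2 → γ ∈ MulAction.stabilizer PSL2Z x := by
    intro γ a ha b hb hab
    by_contra hγ
    have h1 := hεx γ hγ
    have h2 := dist_triangle4 x a (γ • b) (γ • x)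
    rw [dist_smul] at h2
    rw [Metric.mem_ball'] at ha
    rw [Metric.mem_ball] at hb
    linarith
  let : MulAction (MulAction.stabilizer PSL2Z x) (Fin (6 * n)) :=
    MulAction.compHom _ (Φ.comp (MulAction.stabilizer PSL2Z x).subtype)
  obtain ⟨m, r, hinj, hsurj⟩ := exists_bijective_of_free (H := MulAction.stabilizer PSL2Z x)
    (X := Fin (6 * n)) fun h i hi => Subtype.ext (hfree h h.2 i hi)
  refine ⟨ε / 4, by positivity, ?_, m,
    fun j a => MetricQuotient.mk (twistedOrbitRel Φ) ⟨r j, a⟩, hfin, ?_, ?_, ?_, ?_, ?_, ?_⟩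
  · rintro γ ⟨a, ha, hγa⟩
    exact hstab γ _ hγa a ha (by rw [dist_self]; positivity)
  · have := Nat.card_congr (Equiv.ofBijective _ ⟨hinj, hsurj⟩)
    simpa using this
  · intro j a ha b hb
    refine le_antisymm
      ((MetricQuotient.edist_mk_mk_le _ _).trans (Copies.edist_same _ _ _).le) ?_
    rw [MetricQuotient.le_edist_iff]
    intro l hl
    obtain ⟨⟨i, w⟩, hq, hle⟩ :=
      MetricQuotient.exists_edist_le_of_chain twistedOrbitRel_isometric hl rfl
    obtain ⟨γ, hi, rfl⟩ := mk_twisted_eq_iff.mp hq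
    refine le_trans ?_ hle
    by_cases hij : r j = i
    · subst hij
      rw [Copies.edist_same]
      by_cases hγ : γ ∈ MulAction.stabilizer PSL2Z x
      · rw [hfree γ hγ _ hi, one_smul]
      -- every other element moves the ball so far that lifting the chain to it gains nothing
      · rw [edist_dist, edist_dist]
        refine ENNReal.ofReal_le_ofReal ?_
        have h1 : ε / 2 ≤ dist a (γ • b) := not_lt.mp fun h => hγ (hstab γ a ha b hb h)
        have h2 := dist_triangle_right a b x
        rw [Metric.mem_ball] at ha hb
        linarith
    · rw [Copies.edist_of_ne hij]
      exact le_top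
  · intro j
    have hopen : IsOpen ((fun a : ℍ => (⟨r j, a⟩ : Copies (Fin (6 * n)) ℍ)) ''
        Metric.ball x (ε / 4)) := by
      have : (fun a : ℍ => (⟨r j, a⟩ : Copies (Fin (6 * n)) ℍ)) '' Metric.ball x (ε / 4) =
          Metric.eball (⟨r j, x⟩ : Copies (Fin (6 * n)) ℍ) (ENNReal.ofReal (ε / 4)) := by
        ext ⟨i, a⟩
        rw [Metric.mem_eball]
        by_cases hij : i = r j
        · subst hij
          rw [Copies.edist_same, edist_dist,
            ENNReal.ofReal_lt_ofReal_iff (by positivity : 0 < ε / 4)]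
          simp
        · rw [Copies.edist_of_ne hij]
          simp [Ne.symm hij]
      rw [this]
      exact Metric.isOpen_eball
    have := isOpenMap_mk_twisted (Φ := Φ) _ hopen
    rwa [Set.image_image] at this
  · intro j a _
    rfl
  · intro j k hjk
    rw [Set.disjoint_left]
    rintro _ ⟨a, ha, rfl⟩ ⟨b, hb, hab⟩
    obtain ⟨γ, hi, rfl⟩ := mk_twisted_eq_iff.mp hab
    have hγ := hstab γ _ hb a ha (by rw [dist_self]; positivity)
    have := @hinj (k, 1) (j, ⟨γ, hγ⟩) (by
      change (1 : MulAction.stabilizer PSL2Z x) • r k = Φ γ (r j)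
      rw [one_smul, hi])
    exact hjk (congrArg Prod.fst this).symm
  · ext y
    obtain ⟨⟨i, z⟩, rfl⟩ := MetricQuotient.surjective_mk y
    rw [Set.mem_iUnion]
    constructor
    · rintro ⟨a, ha, hza⟩
      obtain ⟨γ, hγ : γ • z = a⟩ := Quotient.exact hza
      obtain ⟨⟨j, h⟩, hj : Φ h (r j) = Φ γ i⟩ := hsurj (Φ γ i)
      refine ⟨j, (h : PSL2Z)⁻¹ • a, ?_, ?_⟩
      · have hx : (h : PSL2Z)⁻¹ • x = x := (h⁻¹).2
        rw [Metric.mem_ball] at ha ⊢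
        have hd := dist_smul (h : PSL2Z)⁻¹ a x
        rw [hx] at hd
        rwa [hd]
      · refine mk_twisted_eq_iff.mpr ⟨(h : PSL2Z)⁻¹ * γ, ?_, by rw [mul_smul, hγ]⟩
        rw [map_mul, Equiv.Perm.mul_apply, ← hj]
        simp
    · rintro ⟨j, a, ha, h⟩
      exact ⟨a, ha, congrArg (twistedProj Φ) h⟩

end Covering

/-! ### The isometry with the glued surface -/

section Gluing

variable {n : ℕ} {σ τ : Equiv.Perm (Fin (6 * n))} {Φ : PSL2Z →* Equiv.Perm (Fin (6 * n))}

theorem TriangleLabelling.label_eq_pow (L : TriangleLabelling n τ) (k : Fin (2 * n)) (s : Fin 3) :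
    L.label (k, s) = (τ ^ (s : ℕ)) (L.label (k, 0)) := by
  have h1 := L.label_succ k 0
  have h2 := L.label_succ k 1
  fin_cases s
  · rfl
  · exact h1
  · change L.label (k, 2) = (τ ^ 2) _
    rw [pow_two, Equiv.Perm.mul_apply, ← h1]
    exact h2

/-- The triangle `k` is placed in the sheet that carries the label of its side `0`. -/
def placeTriangle (L : TriangleLabelling n τ) (p : Copies (Fin (2 * n)) idealTriangle) :
    Copies (Fin (6 * n)) ℍ :=
  ⟨L.label (p.idx, 0), p.pt⟩

theorem edist_placeTriangle (L : TriangleLabelling n τ)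
    (p q : Copies (Fin (2 * n)) idealTriangle) :
    edist (placeTriangle L p) (placeTriangle L q) = edist p q := by
  obtain ⟨k, z⟩ := p
  obtain ⟨k', w⟩ := q
  by_cases h : k = k'
  · subst h
    rw [Copies.edist_same]
    exact Copies.edist_same _ _ _
  · rw [Copies.edist_of_ne h]
    exact Copies.edist_of_ne (fun e => h (congrArg Prod.fst (L.label.injective e))) _ _

/-- The element of `PSL(2, ℤ)` that reverses side `0` of the triangle, read off in the triangles
turned by `s` and `s'`, carries side `s` to side `s'`. -/
theorem mk_placeTriangle_eq_of_sideGluing (hB : Φ genB = σ) (hC : Φ genC = τ)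
    (L : TriangleLabelling n τ) {p q : Copies (Fin (2 * n)) idealTriangle}
    (h : SideGluing σ L p q) :
    MetricQuotient.mk (twistedOrbitRel Φ) (placeTriangle L p) =
      MetricQuotient.mk (twistedOrbitRel Φ) (placeTriangle L q) := by
  obtain ⟨k, k', s, s', t, h⟩ := h
  refine Eq.symm (mk_twisted_eq_iff.mpr
    ⟨(genC ^ (s' : ℕ))⁻¹ * (genB * genC ^ (s : ℕ)), ?_, ?_⟩)
  · simp only [map_mul, map_inv, map_pow, hB, hC, Equiv.Perm.mul_apply]
    rw [Equiv.Perm.inv_eq_iff_eq, ← L.label_eq_pow, ← L.label_eq_pow, h]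
  · change ((genC ^ (s' : ℕ))⁻¹ * (genB * genC ^ (s : ℕ))) • sidePoint s t = sidePoint s' (-t)
    rw [mul_smul, mul_smul, inv_smul_eq_iff, genC_pow_smul_sidePoint, genC_pow_smul_sidePoint,
      genB_smul_sidePoint]

/-- The map from the glued surface to the quotient of `ℍ × [6n]` that places each triangle in a
sheet. -/
noncomputable def gluedToTwisted (hB : Φ genB = σ) (hC : Φ genC = τ) (L : TriangleLabelling n τ) :
    GluedSurface σ L → TwistedQuotient Φ :=
  Quotient.lift (fun p => MetricQuotient.mk (twistedOrbitRel Φ) (placeTriangle L p)) (by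
    intro p q h
    induction h with
    | rel p q h => exact mk_placeTriangle_eq_of_sideGluing hB hC L h
    | refl p => rfl
    | symm p q _ ih => exact ih.symm
    | trans p q r _ _ ih ih' => exact ih.trans ih')

theorem gluedToTwisted_mk (hB : Φ genB = σ) (hC : Φ genC = τ) (L : TriangleLabelling n τ)
    (p : Copies (Fin (2 * n)) idealTriangle) :
    gluedToTwisted hB hC L (MetricQuotient.mk _ p) =
      MetricQuotient.mk (twistedOrbitRel Φ) (placeTriangle L p) := rfl

/-- Points of triangles that are identified in the quotient of `ℍ × [6n]` are identified by the
gluing, since tiles of the Farey tessellation meet only along sides. -/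
theorem gluedToTwisted_injective (hB : Φ genB = σ) (hC : Φ genC = τ) (L : TriangleLabelling n τ) :
    Function.Injective (gluedToTwisted hB hC L) := by
  intro x y h
  obtain ⟨⟨k', z', hz'⟩, rfl⟩ := MetricQuotient.surjective_mk x
  obtain ⟨⟨k, z, hz⟩, rfl⟩ := MetricQuotient.surjective_mk y
  rw [gluedToTwisted_mk, gluedToTwisted_mk] at h
  obtain ⟨γ, hi, hγ⟩ := mk_twisted_eq_iff.mp h
  change Φ γ (L.label (k, 0)) = L.label (k', 0) at hi
  change γ • z = z' at hγ
  subst hγ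
  rcases genC_pow_or_of_smul_mem hz hz' with ⟨s, rfl⟩ | ⟨s, s', rfl, h0⟩
  · rw [map_pow, hC, ← L.label_eq_pow] at hi
    obtain ⟨rfl, rfl⟩ := Prod.mk.inj (L.label.injective hi)
    simp
  · obtain ⟨t, ht⟩ := exists_sidePoint_eq h0
    obtain rfl : z = sidePoint s t := by
      rw [← genC_pow_smul_sidePoint s t] at ht
      exact MulAction.injective _ ht
    simp only [map_mul, map_inv, map_pow, hB, hC, Equiv.Perm.mul_apply] at hi
    rw [Equiv.Perm.inv_eq_iff_eq, ← L.label_eq_pow, ← L.label_eq_pow] at hi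
    have hpt : ((genC ^ (s' : ℕ))⁻¹ * (genB * genC ^ (s : ℕ))) • sidePoint s t =
        sidePoint s' (-t) := by
      rw [mul_smul, mul_smul, inv_smul_eq_iff, ht, genC_pow_smul_sidePoint, genB_smul_sidePoint]
    simp only [hpt]
    exact (Quotient.sound (Relation.EqvGen.rel _ _ (SideGluing.glue k k' s s' t hi.symm))).symm

/-- On the part of a sheet that lies over a tile, the projection to the quotient factors through
one of the triangles by an isometry. -/
theorem exists_mk_eq_gluedToTwisted (h3 : τ ^ 3 = 1) (hB : Φ genB = σ) (hC : Φ genC = τ)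
    (L : TriangleLabelling n τ) (δ : PSL2Z) (i : Fin (6 * n)) :
    ∃ (k : Fin (2 * n)) (s : ℕ), ∀ (z : ℍ) (hz : δ • z ∈ idealTriangle),
      gluedToTwisted hB hC L (MetricQuotient.mk _ ⟨k, ⟨genC ^ s • δ • z, genC_pow_smul_mem hz s⟩⟩) =
        MetricQuotient.mk (twistedOrbitRel Φ) ⟨i, z⟩ := by
  obtain ⟨⟨k, s⟩, hks⟩ := L.label.surjective (Φ δ i)
  refine ⟨k, 3 - s, fun z hz => ?_⟩
  rw [gluedToTwisted_mk]
  refine mk_twisted_eq_iff.mpr ⟨genC ^ (3 - s : ℕ) * δ, ?_, mul_smul _ _ _⟩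
  change _ = L.label (k, 0)
  rw [map_mul, map_pow, hC, Equiv.Perm.mul_apply, ← hks, L.label_eq_pow, ← Equiv.Perm.mul_apply,
    ← pow_add, Nat.sub_add_cancel s.is_lt.le, h3, Equiv.Perm.one_apply]

theorem gluedToTwisted_surjective (h3 : τ ^ 3 = 1) (hB : Φ genB = σ) (hC : Φ genC = τ)
    (L : TriangleLabelling n τ) : Function.Surjective (gluedToTwisted hB hC L) := by
  intro y
  obtain ⟨⟨i, z⟩, rfl⟩ := MetricQuotient.surjective_mk y
  obtain ⟨δ, hδ⟩ := exists_smul_mem_idealTriangle z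
  obtain ⟨k, s, h⟩ := exists_mk_eq_gluedToTwisted h3 hB hC L δ i
  exact ⟨_, h z hδ⟩

theorem nonempty_isometryEquiv (h3 : τ ^ 3 = 1) (hB : Φ genB = σ) (hC : Φ genC = τ)
    (L : TriangleLabelling n τ) : Nonempty (TwistedQuotient Φ ≃ᵢ GluedSurface σ L) := by
  let e : GluedSurface σ L ≃ TwistedQuotient Φ := Equiv.ofBijective (gluedToTwisted hB hC L)
    ⟨gluedToTwisted_injective hB hC L, gluedToTwisted_surjective h3 hB hC L⟩
  have hsymm : ∀ x, e.symm (gluedToTwisted hB hC L x) = x := e.symm_apply_apply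
  have hle : ∀ x y, edist (e x) (e y) ≤ edist x y :=
    MetricQuotient.edist_map_le fun p q =>
      (MetricQuotient.edist_mk_mk_le _ _).trans (edist_placeTriangle L p q).le
  have hge : ∀ x y, edist (e.symm x) (e.symm y) ≤ edist x y := by
    refine MetricQuotient.edist_map_le ?_
    rintro ⟨i, z⟩ ⟨j, w⟩
    by_cases hij : i = j
    · subst hij
      rw [Copies.edist_same]
      refine edist_le_of_eventually_edist_le_upperHalfPlane
        (f := fun z => e.symm (MetricQuotient.mk (twistedOrbitRel Φ) ⟨i, z⟩)) (fun z => ?_) z w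
      -- nearby points share a tile, which is isometric to one of the glued triangles
      obtain ⟨F, -, hF⟩ := exists_finite_eventually_mem_idealTriangle z
      filter_upwards [hF] with w h
      obtain ⟨δ, -, hz, hw⟩ := h
      obtain ⟨k, s, h⟩ := exists_mk_eq_gluedToTwisted h3 hB hC L δ i
      have hz' := (congrArg e.symm (h z hz)).symm.trans (hsymm _)
      have hw' := (congrArg e.symm (h w hw)).symm.trans (hsymm _)
      change edist (e.symm (MetricQuotient.mk (twistedOrbitRel Φ) ⟨i, z⟩))
        (e.symm (MetricQuotient.mk (twistedOrbitRel Φ) ⟨i, w⟩)) ≤ _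
      rw [hz', hw']
      refine (MetricQuotient.edist_mk_mk_le _ _).trans ?_
      rw [Copies.edist_same, Subtype.edist_mk_mk, edist_smul_left, edist_smul_left]
    · rw [Copies.edist_of_ne hij]
      exact le_top
  refine ⟨(IsometryEquiv.mk e fun x y => le_antisymm (hle x y) ?_).symm⟩
  simpa using hge (e x) (e y)

end Gluing

end BrooksMakover

theorem theorem2p4 (n : ℕ) (hn : 1 ≤ n) (σ τ : Equiv.Perm (Fin (6 * n)))
    (hστ : (σ, τ) ∈ BrooksMakover.permPairs n) :
    (∃! Φ : BrooksMakover.PSL2Z →* Equiv.Perm (Fin (6 * n)),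
      Φ BrooksMakover.genB = σ ∧ Φ BrooksMakover.genC = τ) ∧
    Nonempty (BrooksMakover.TriangleLabelling n τ) ∧
    ∀ Φ : BrooksMakover.PSL2Z →* Equiv.Perm (Fin (6 * n)),
      Φ BrooksMakover.genB = σ → Φ BrooksMakover.genC = τ →
      Topology.IsQuotientMap (BrooksMakover.MetricQuotient.mk (BrooksMakover.twistedOrbitRel Φ)) ∧
      BrooksMakover.IsOrbifoldCoveringSurface (BrooksMakover.twistedProj Φ) (6 * n) ∧
      ∀ L : BrooksMakover.TriangleLabelling n τ,
        Nonempty (BrooksMakover.TwistedQuotient Φ ≃ᵢ BrooksMakover.GluedSurface σ L) := by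
  obtain ⟨hσ2, hσ, hτ3, hτ⟩ := hστ
  have h2 : σ ^ 2 = 1 := by rw [← hσ2, pow_orderOf_eq_one]
  have h3 : τ ^ 3 = 1 := by rw [← hτ3, pow_orderOf_eq_one]
  exact ⟨BrooksMakover.existsUnique_hom h2 h3,
    BrooksMakover.nonempty_triangleLabelling hτ3 hτ, fun Φ hB hC =>
      ⟨BrooksMakover.isQuotientMap_mk_twisted,
        BrooksMakover.isOrbifoldCoveringSurface_twistedProj hn hσ h3 hτ hB hC,
        BrooksMakover.nonempty_isometryEquiv h3 hB hC⟩⟩
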